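/- Let $N\ge 1$, $1<q\le p$, $0<\alpha<N$, $c>0$, and let $\Omega\subset\mathbb R^N$ be a bounded open set. Then there is a constant $C>0$, depending only on $N,p,q,\alpha,c$ and $\Omega$, such that the following holds. Let $J:\mathbb R^N\to\mathbb R$ be measurable with $J(z)=J(-z)$ for all $z$, $J(z)>0$ for $z\ne0$, $J\notin L^1(\{|z|<1\})$ and $\int_{\mathbb R^N}\min(1,|z|^{q_0})J(z)\,dz<\infty$ for some $q_0>0$, and suppose that $$J(z)\ge c\,|z|^{-N-\alpha}\qquad\text{for } 0<|z|<1 .$$ Let $\Psi\in\Gamma_{p,q}$, that is, $\Psi:\mathbb R\to[0,\infty)$ is convex and even, $\Psi(0)=0$, $\Psi(1)=1$, $\Psi$ is differentiable on $\mathbb R\setminus\{0\}$, and $q\le \frac{s\Psi'(s)}{\Psi(s)}\le p$ for all $s\ne0$. Put $$E(u)=\frac12\iint_{\mathbb R^{2N}}\Psi(u(x)-u(y))\,J(x-y)\,dx\,dy ,$$ and let $W_0^{J,\Psi}(\Omega)$ be the set of measurable $u:\mathbb R^N\to\mathbb R$ with $\int_{\mathbb R^N}\Psi(u)\,dx<\infty$,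 $E(u)<\infty$ and $u=0$ a.e. in $\mathbb R^N\setminus\Omega$. Then for every $u\in W_0^{J,\Psi}(\Omega)$ and every $1\le r\le \frac N{N-\alpha}$ we have $\int_\Omega\Psi(u(x))^r\,dx<\infty$ (that is, $u\in L^{\Psi^r}(\Omega)$) and $$\|\Psi(u)\|_{L^r(\Omega)}\le C\,E(u).$$ -/

import Mathlib

open MeasureTheory
open scoped ENNReal

namespace NonlocalOrlicz

noncomputable section

/-- The class `Γ_{p,q}` of Young functions lying between the powers `q` and `p`: nonnegative, convex,
even functions on `ℝ` with `Ψ 0 = 0`, `Ψ 1 = 1`, differentiable off the origin, with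
`q ≤ s Ψ'(s) / Ψ(s) ≤ p` for all `s ≠ 0`.  (It is used for `p ≥ q > 1`, and then the lower bound
forces `Ψ s > 0` for `s ≠ 0`.) -/
structure IsGamma (p q : ℝ) (Ψ : ℝ → ℝ) : Prop where
  nonneg : ∀ s, 0 ≤ Ψ s
  convex : ConvexOn ℝ Set.univ Ψ
  even : ∀ s, Ψ (-s) = Ψ s
  map_zero : Ψ 0 = 0
  map_one : Ψ 1 = 1
  differentiableAt : ∀ s, s ≠ 0 → DifferentiableAt ℝ Ψ s
  lower : ∀ s, s ≠ 0 → q ≤ s * deriv Ψ s / Ψ s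
  upper : ∀ s, s ≠ 0 → s * deriv Ψ s / Ψ s ≤ p

/-- The standing hypotheses on the kernel: `J` is (Lebesgue) measurable, positive and even, it is not
integrable on the unit ball, and `∫ min(1, |z|^{q₀}) J(z) dz < ∞` for some `q₀ > 0`.
The value at the single point `z = 0` is left free. -/
structure IsKernel {N : ℕ} (J : EuclideanSpace ℝ (Fin N) → ℝ) : Prop where
  aemeasurable : AEMeasurable J volume
  pos : ∀ z, z ≠ 0 → 0 < J z
  even : ∀ z, J (-z) = J z
  not_integrableOn : ¬ IntegrableOn J (Metric.ball 0 1) volume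
  exists_integrable : ∃ q₀ : ℝ, 0 < q₀ ∧ Integrable (fun z => min 1 (‖z‖ ^ q₀) * J z) volume

/-- The energy `E(u) = 1/2 ∬ Ψ(u(x) - u(y)) J(x - y) dx dy`, with values in `[0, ∞]`. -/
def energy {N : ℕ} (J : EuclideanSpace ℝ (Fin N) → ℝ) (Ψ : ℝ → ℝ)
    (u : EuclideanSpace ℝ (Fin N) → ℝ) : ℝ≥0∞ :=
  2⁻¹ * ∫⁻ x, ∫⁻ y, ENNReal.ofReal (Ψ (u x - u y) * J (x - y))

/-- The Orlicz space `L^G(S)`: measurable functions with `∫_S G(u(x)) dx < ∞`. -/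
def orliczSpace {N : ℕ} (G : ℝ → ℝ) (S : Set (EuclideanSpace ℝ (Fin N))) :
    Set (EuclideanSpace ℝ (Fin N) → ℝ) :=
  {u | AEMeasurable u (volume.restrict S) ∧ ∫⁻ x in S, ENNReal.ofReal (G (u x)) < ∞}

/-- The Sobolev-type space `W^{J,Ψ}(ℝ^N)`: functions of `L^Ψ(ℝ^N)` of finite energy. -/
def sobolevSpace {N : ℕ} (J : EuclideanSpace ℝ (Fin N) → ℝ) (Ψ : ℝ → ℝ) :
    Set (EuclideanSpace ℝ (Fin N) → ℝ) :=
  {u | u ∈ orliczSpace Ψ Set.univ ∧ energy J Ψ u < ∞}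

/-- The space `W₀^{J,Ψ}(Ω)`: functions of `W^{J,Ψ}(ℝ^N)` that vanish (almost everywhere) outside
`Ω`. -/
def sobolevSpaceZero {N : ℕ} (J : EuclideanSpace ℝ (Fin N) → ℝ) (Ψ : ℝ → ℝ)
    (Ω : Set (EuclideanSpace ℝ (Fin N))) : Set (EuclideanSpace ℝ (Fin N) → ℝ) :=
  {u | u ∈ sobolevSpace J Ψ ∧ ∀ᵐ x, x ∉ Ω → u x = 0}

end

end NonlocalOrlicz

/-! Only two features of `Ψ` matter: monotonicity in `|s|` and a quasi-triangle inequality with `K =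
2^p`, so constants depend on `p` alone. Write `F(x) = Φ(w x) + ∫ Φ(w x - w y) k(x - y) dy` and `M`
for the critical norm of `Φ(w)`. Averaging the quasi-triangle inequality over a ball of radius `t`
bounds `Φ(w x)` by a multiple of `t^α F(x) + t^(α-N) M`: the kernel bound controls the differences,
Hölder the rest (`exists_le_rpow_mul_add`). The best `t` gives `Φ(w x)^(N/(N-α)) ≤ C M^(α/(N-α))
F(x)` (`exists_rpow_le`). Integrating, absorbing `∫ Φ(w)` by a Poincaré inequality
(`exists_lintegral_le`) and cancelling the power of `M` gives the critical case when `M` is finite.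
Truncation removes that restriction, and Hölder on `Ω` covers smaller `r`. -/

namespace NonlocalOrlicz

/-- Functions `Φ : ℝ → [0, ∞)`, nondecreasing in `|s|`, satisfying the quasi-triangle
inequality `Φ (a + b) ≤ K (Φ a + Φ b)`. -/
structure IsDoubling (K : ℝ≥0∞) (Φ : ℝ → ℝ≥0∞) : Prop where
  measurable : Measurable Φ
  map_zero : Φ 0 = 0
  mono : ∀ s t, |s| ≤ |t| → Φ s ≤ Φ t
  ne_top : ∀ s, Φ s ≠ ∞
  add_le : ∀ a b, Φ (a + b) ≤ K * (Φ a + Φ b)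

/-! ### Growth of `Ψ`: from the index bounds to the quasi-triangle inequality. -/

namespace IsGamma

variable {p q : ℝ} {Ψ : ℝ → ℝ}

theorem pos (h : IsGamma p q Ψ) (hq : 0 < q) {s : ℝ} (hs : s ≠ 0) : 0 < Ψ s := by
  refine lt_of_le_of_ne (h.nonneg s) fun h0 => ?_
  have := h.lower s hs
  -- Since `x / 0 = 0`, a zero of `Ψ` would turn the lower index bound into `q ≤ 0`.
  rw [← h0, div_zero] at this
  linarith

theorem continuous (h : IsGamma p q Ψ) : Continuous Ψ :=
  continuousOn_univ.1 (h.convex.continuousOn isOpen_univ)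

theorem mono_abs (h : IsGamma p q Ψ) {s t : ℝ} (hst : |s| ≤ |t|) : Ψ s ≤ Ψ t := by
  have habs : Ψ |t| = Ψ t := by
    rcases abs_choice t with h' | h' <;> rw [h']
    exact h.even t
  have hseg : s ∈ segment ℝ (-|t|) |t| := by
    rw [segment_eq_Icc (by linarith [abs_nonneg t])]
    exact abs_le.1 hst
  have := h.convex.le_max_of_mem_segment (Set.mem_univ _) (Set.mem_univ _) hseg
  rwa [h.even, max_self, habs] at this

/-- The derivative is `s^(-p-1) (s Ψ'(s) - p Ψ(s))`, and the upper index bound makes the bracket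
nonpositive. -/
theorem antitoneOn_div_rpow (h : IsGamma p q Ψ) (hq : 0 < q) :
    AntitoneOn (fun s => Ψ s * s ^ (-p)) (Set.Ioi 0) := by
  have hd : ∀ s : ℝ, 0 < s → HasDerivAt (fun s => Ψ s * s ^ (-p))
      (deriv Ψ s * s ^ (-p) + Ψ s * (-p * s ^ (-p - 1))) s := fun s hs =>
    (h.differentiableAt s hs.ne').hasDerivAt.mul (Real.hasDerivAt_rpow_const (Or.inl hs.ne'))
  refine antitoneOn_of_deriv_nonpos (convex_Ioi 0)
    (fun s hs => (hd s hs).continuousAt.continuousWithinAt) ?_ ?_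
  · rw [interior_Ioi]
    exact fun s hs => (hd s hs).differentiableAt.differentiableWithinAt
  · rw [interior_Ioi]
    intro s (hs : 0 < s)
    rw [(hd s hs).deriv]
    have hu := h.upper s hs.ne'
    rw [div_le_iff₀ (h.pos hq hs.ne')] at hu
    have hr : s ^ (-p) = s ^ (-p - 1) * s := by
      rw [← Real.rpow_add_one hs.ne']; ring_nf
    have hpos : 0 < s ^ (-p - 1) := Real.rpow_pos_of_pos hs _
    rw [hr]
    nlinarith [mul_nonneg hpos.le (sub_nonneg.2 hu)]

theorem two_mul_le (h : IsGamma p q Ψ) (hq : 0 < q) (s : ℝ) : Ψ (2 * s) ≤ 2 ^ p * Ψ s := by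
  wlog hs : 0 < s generalizing s
  · rcases (not_lt.1 hs).lt_or_eq with hs | hs
    · have := this (-s) (by linarith)
      rwa [mul_neg, h.even, h.even] at this
    · simp [hs, h.map_zero]
  have h1 := h.antitoneOn_div_rpow hq (Set.mem_Ioi.2 hs) (Set.mem_Ioi.2 (by linarith : 0 < 2 * s))
    (by linarith)
  simp only [Real.mul_rpow zero_le_two hs.le, Real.rpow_neg zero_le_two, Real.rpow_neg hs.le] at h1
  have h2 : (0 : ℝ) < 2 ^ p := by positivity
  have h3 : (0 : ℝ) < s ^ p := Real.rpow_pos_of_pos hs _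
  field_simp at h1
  linarith

/-- Doubling bounds `Ψ (a + b)` by `2^p` times the value at the midpoint of `a` and `b`; convexity
finishes. -/
theorem isDoubling (h : IsGamma p q Ψ) (hq : 0 < q) :
    IsDoubling (ENNReal.ofReal (2 ^ p)) (fun s => ENNReal.ofReal (Ψ s)) where
  measurable := h.continuous.measurable.ennreal_ofReal
  map_zero := by simp [h.map_zero]
  mono s t hst := ENNReal.ofReal_le_ofReal (h.mono_abs hst)
  ne_top s := ENNReal.ofReal_ne_top
  add_le a b := by
    rw [← ENNReal.ofReal_add (h.nonneg _) (h.nonneg _), ← ENNReal.ofReal_mul (by positivity)]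
    refine ENNReal.ofReal_le_ofReal ?_
    have h1 := h.two_mul_le hq ((1 / 2 : ℝ) * a + (1 / 2 : ℝ) * b)
    have h2 := h.convex.2 (Set.mem_univ a) (Set.mem_univ b) (by norm_num : (0 : ℝ) ≤ 1 / 2)
      (by norm_num : (0 : ℝ) ≤ 1 / 2) (by norm_num)
    simp only [smul_eq_mul] at h2
    have h3 : 2 * ((1 / 2 : ℝ) * a + (1 / 2 : ℝ) * b) = a + b := by ring
    rw [h3] at h1
    have h4 : (0 : ℝ) < 2 ^ p := by positivity
    nlinarith [h.nonneg a, h.nonneg b]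

end IsGamma

variable {N : ℕ} {K : ℝ≥0∞} {Φ : ℝ → ℝ≥0∞} {w : EuclideanSpace ℝ (Fin N) → ℝ}

/-! ### Translations and the Poincaré inequality. -/

namespace IsDoubling

theorem sub_le (h : IsDoubling K Φ) (a b c : ℝ) : Φ (a - c) ≤ K * (Φ (a - b) + Φ (b - c)) := by
  simpa using h.add_le (a - b) (b - c)

/-- Telescoping: by translation invariance each further step contributes the same integral, at the
cost of a factor at most `2 * K`. -/
theorem lintegral_sub_translate_le (h : IsDoubling K Φ) (hK : 1 ≤ K) (hw : Measurable w)
    (z : EuclideanSpace ℝ (Fin N)) (m : ℕ) :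
    ∫⁻ x, Φ (w x - w (x + m • z)) ≤ (2 * K) ^ m * ∫⁻ x, Φ (w x - w (x + z)) := by
  have hΦ := h.measurable
  induction m with
  | zero => simp [h.map_zero]
  | succ m ih =>
    set I := ∫⁻ x, Φ (w x - w (x + z))
    have hI : ∫⁻ x, Φ (w (x + m • z) - w (x + (m + 1) • z)) = I := by
      refine Eq.trans ?_ (lintegral_add_right_eq_self (fun x => Φ (w x - w (x + z))) (m • z))
      simp only [add_smul, one_smul, add_assoc]
    calc ∫⁻ x, Φ (w x - w (x + (m + 1) • z))
        ≤ ∫⁻ x, K * (Φ (w x - w (x + m • z)) + Φ (w (x + m • z) - w (x + (m + 1) • z))) :=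
          lintegral_mono fun x => h.sub_le _ _ _
      _ = K * ((∫⁻ x, Φ (w x - w (x + m • z))) + I) := by
          rw [lintegral_const_mul _ (by fun_prop), lintegral_add_left (by fun_prop), hI]
      _ ≤ K * ((2 * K) ^ m * I + (2 * K) ^ m * I) := by
          gcongr
          refine le_mul_of_one_le_left zero_le (one_le_pow₀ ?_)
          exact one_le_mul (by norm_num) hK
      _ = (2 * K) ^ (m + 1) * I := by ring

/-- Poincaré inequality for functions vanishing outside a ball. -/
theorem exists_lintegral_le (hN : 0 < N) (hK : 1 ≤ K) (hKt : K ≠ ∞) {c : ℝ≥0∞} (hc : c ≠ 0)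
    (hct : c ≠ ∞) (R : ℝ) :
    ∃ C : ℝ≥0∞, C ≠ ∞ ∧ ∀ (Φ : ℝ → ℝ≥0∞) (k : EuclideanSpace ℝ (Fin N) → ℝ≥0∞)
      (w : EuclideanSpace ℝ (Fin N) → ℝ), IsDoubling K Φ →
      (∀ z, 0 < ‖z‖ → ‖z‖ < 1 → c ≤ k z) → Measurable w → (∀ x, R ≤ ‖x‖ → w x = 0) →
      ∫⁻ x, Φ (w x) ≤ C * ∫⁻ x, ∫⁻ y, Φ (w x - w y) * k (x - y) := by
  have : Nonempty (Fin N) := ⟨⟨0, hN⟩⟩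
  -- Every `z` in the ball `A` has norm in `(1/2, 1)`: the kernel is bounded below there, and `m ≥
  -- 4R` steps of `z` carry any point of the `R`-ball outside it.
  obtain ⟨z₀, hz₀⟩ := exists_norm_eq (EuclideanSpace ℝ (Fin N)) (show (0 : ℝ) ≤ 3 / 4 by norm_num)
  obtain ⟨m, hm⟩ := exists_nat_ge (4 * R)
  set A := Metric.ball z₀ (1 / 4) with hA
  have hAz : ∀ z ∈ A, 1 / 2 < ‖z‖ ∧ ‖z‖ < 1 := by
    intro z hz
    rw [hA, mem_ball_iff_norm] at hz
    have h1 := norm_sub_norm_le z₀ z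
    have h2 := norm_sub_norm_le z z₀
    rw [norm_sub_rev] at h1
    constructor <;> linarith
  have hA0 : volume A ≠ 0 := (Metric.measure_ball_pos volume z₀ (by norm_num)).ne'
  have hAt : volume A ≠ ∞ := measure_ball_lt_top.ne
  refine ⟨(volume A)⁻¹ * ((2 * K) ^ m * c⁻¹), by finiteness, ?_⟩
  intro Φ k w h hk hw hw0
  have hΦ := h.measurable
  set P := ∫⁻ x, Φ (w x)
  have hP : ∀ z ∈ A, P ≤ (2 * K) ^ m * ∫⁻ x, Φ (w x - w (x + z)) := by
    intro z hz
    refine le_trans (lintegral_mono fun x => ?_) (h.lintegral_sub_translate_le hK hw z m)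
    by_cases hx : R ≤ ‖x‖
    · simp [hw0 x hx, h.map_zero]
    · have : w (x + m • z) = 0 := by
        refine hw0 _ ?_
        have h1 : ‖m • z‖ ≤ ‖x + m • z‖ + ‖x‖ := by
          simpa using norm_sub_le (x + m • z) x
        have h2 : ‖m • z‖ = m * ‖z‖ := by rw [← Nat.cast_smul_eq_nsmul ℝ, norm_smul]; simp
        have := (hAz z hz).1
        nlinarith [(Nat.cast_nonneg m : (0 : ℝ) ≤ m)]
      simp [this]
  have hE : ∫⁻ z in A, ∫⁻ x, Φ (w x - w (x + z)) ≤
      c⁻¹ * ∫⁻ x, ∫⁻ y, Φ (w x - w y) * k (x - y) := by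
    rw [lintegral_lintegral_swap (by fun_prop), ← lintegral_const_mul' _ _ (by finiteness)]
    refine lintegral_mono fun x => ?_
    rw [← lintegral_const_mul' _ _ (by finiteness),
      ← lintegral_add_left_eq_self (μ := volume) _ x]
    refine le_trans (setLIntegral_mono' (g := fun z =>
      c⁻¹ * (Φ (w x - w (x + z)) * k (x - (x + z)))) measurableSet_ball fun z hz => ?_)
      (setLIntegral_le_lintegral _ _)
    rw [mul_left_comm]
    refine le_mul_of_one_le_right zero_le ?_
    rw [← ENNReal.inv_mul_cancel hc hct]
    gcongr
    have := hAz z hz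
    refine hk _ ?_ ?_ <;> simp only [sub_add_cancel_left, norm_neg] <;> linarith
  calc P = (volume A)⁻¹ * ∫⁻ z in A, P := by
        rw [setLIntegral_const, mul_comm P, ← mul_assoc, ENNReal.inv_mul_cancel hA0 hAt, one_mul]
    _ ≤ (volume A)⁻¹ * ∫⁻ z in A, (2 * K) ^ m * ∫⁻ x, Φ (w x - w (x + z)) := by
        gcongr 1
        exact setLIntegral_mono' measurableSet_ball hP
    _ ≤ _ := by
        rw [lintegral_const_mul' _ _ (by finiteness), mul_assoc, mul_assoc]
        gcongr

/-! ### Pointwise estimates at a variable radius. -/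

/-- Averaging `Φ (w x) ≤ K (Φ (w x - w y) + Φ (w y))` over a small ball around `x`. -/
theorem measure_ball_mul_le (h : IsDoubling K Φ) (hN : 0 < N) (hKt : K ≠ ∞) {α c : ℝ} (hα : 0 < α)
    (hαN : α < N) (hc : 0 < c) {k : EuclideanSpace ℝ (Fin N) → ℝ≥0∞}
    (hk : ∀ z, 0 < ‖z‖ → ‖z‖ < 1 → ENNReal.ofReal (c * ‖z‖ ^ (-(N : ℝ) - α)) ≤ k z)
    (hw : Measurable w) (x : EuclideanSpace ℝ (Fin N)) {ρ : ℝ} (hρ : 0 < ρ) (hρ1 : ρ ≤ 1) :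
    volume (Metric.ball x ρ) * Φ (w x) ≤
      K * (ENNReal.ofReal (c⁻¹ * ρ ^ (N + α)) * (∫⁻ y, Φ (w x - w y) * k (x - y)) +
        (∫⁻ y, Φ (w y) ^ ((N : ℝ) / (N - α))) ^ (1 / ((N : ℝ) / (N - α))) *
          volume (Metric.ball x ρ) ^ (α / N)) := by
  have hΦ := h.measurable
  have hN' : (0 : ℝ) < N := by exact_mod_cast hN
  have hNα : (0 : ℝ) < N - α := by linarith
  set B := Metric.ball x ρ with hB
  have h1 : ∫⁻ y in B, Φ (w x - w y) ≤
      ENNReal.ofReal (c⁻¹ * ρ ^ (N + α)) * ∫⁻ y, Φ (w x - w y) * k (x - y) := by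
    rw [← lintegral_const_mul' _ _ (by finiteness)]
    refine le_trans (setLIntegral_mono' (g := fun y => ENNReal.ofReal (c⁻¹ * ρ ^ (N + α)) *
      (Φ (w x - w y) * k (x - y))) measurableSet_ball fun y hy => ?_)
      (setLIntegral_le_lintegral _ _)
    rcases eq_or_ne y x with rfl | hyx
    · simp [h.map_zero]
    have h0 : 0 < ‖x - y‖ := norm_pos_iff.2 (sub_ne_zero.2 hyx.symm)
    have hlt : ‖x - y‖ < ρ := by rwa [← mem_ball_iff_norm', ← hB]
    rw [mul_left_comm]
    refine le_mul_of_one_le_right zero_le ?_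
    refine le_trans ?_ (mul_le_mul_right (hk _ h0 (by linarith)) _)
    rw [← ENNReal.ofReal_mul (by positivity), ← ENNReal.ofReal_one]
    refine ENNReal.ofReal_le_ofReal ?_
    have h2 : ρ ^ (-(N : ℝ) - α) ≤ ‖x - y‖ ^ (-(N : ℝ) - α) :=
      Real.rpow_le_rpow_of_nonpos h0 hlt.le (by linarith)
    calc (1 : ℝ) = c⁻¹ * ρ ^ (N + α) * (c * ρ ^ (-(N : ℝ) - α)) := by
          rw [show -(N : ℝ) - α = -(N + α) by ring, Real.rpow_neg hρ.le]
          have : 0 < ρ ^ (N + α) := Real.rpow_pos_of_pos hρ _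
          field_simp
      _ ≤ _ := by gcongr
  have h2 : ∫⁻ y in B, Φ (w y) ≤
      (∫⁻ y, Φ (w y) ^ ((N : ℝ) / (N - α))) ^ (1 / ((N : ℝ) / (N - α))) * volume B ^ (α / N) := by
    have hpq : ((N : ℝ) / (N - α)).HolderConjugate (N / α) := by
      rw [Real.holderConjugate_iff]
      constructor
      · rw [lt_div_iff₀ hNα]; linarith
      · field_simp; ring
    have := ENNReal.lintegral_mul_le_Lp_mul_Lq (volume.restrict B) hpq
      (f := fun y => Φ (w y)) (g := fun _ => 1) (by fun_prop) (by fun_prop)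
    simp only [Pi.mul_apply, mul_one, ENNReal.one_rpow, lintegral_one, Measure.restrict_apply_univ,
      one_div_div] at this
    rw [one_div_div]
    refine this.trans ?_
    gcongr
    exact Measure.restrict_le_self
  calc volume B * Φ (w x) = ∫⁻ y in B, Φ (w x) := by rw [setLIntegral_const, mul_comm]
    _ ≤ ∫⁻ y in B, K * (Φ (w x - w y) + Φ (w y)) :=
        lintegral_mono fun y => by simpa using h.add_le (w x - w y) (w y)
    _ = K * ((∫⁻ y in B, Φ (w x - w y)) + ∫⁻ y in B, Φ (w y)) := by
        rw [lintegral_const_mul' _ _ hKt, lintegral_add_left (by fun_prop)]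
    _ ≤ _ := by gcongr

/-- Division by the volume of the ball gives the case `t < 1`. The extra `Φ (w x)` next to the
integral makes `t ≥ 1` trivial, so the later optimisation in `t` is unconstrained. -/
theorem exists_le_rpow_mul_add (hN : 0 < N) (hKt : K ≠ ∞) {α c : ℝ} (hα : 0 < α)
    (hαN : α < N) (hc : 0 < c) :
    ∃ C : ℝ≥0∞, C ≠ ∞ ∧ ∀ (Φ : ℝ → ℝ≥0∞) (k : EuclideanSpace ℝ (Fin N) → ℝ≥0∞)
      (w : EuclideanSpace ℝ (Fin N) → ℝ), IsDoubling K Φ →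
      (∀ z, 0 < ‖z‖ → ‖z‖ < 1 → ENNReal.ofReal (c * ‖z‖ ^ (-(N : ℝ) - α)) ≤ k z) →
      Measurable w → ∀ (x : EuclideanSpace ℝ (Fin N)) (t : ℝ≥0∞), t ≠ 0 → t ≠ ∞ →
      Φ (w x) ≤ C * (t ^ α * (Φ (w x) + ∫⁻ y, Φ (w x - w y) * k (x - y)) + t ^ (α - N) *
        (∫⁻ y, Φ (w y) ^ ((N : ℝ) / (N - α))) ^ (1 / ((N : ℝ) / (N - α)))) := by
  have : Nonempty (Fin N) := ⟨⟨0, hN⟩⟩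
  have hN' : (0 : ℝ) < N := by exact_mod_cast hN
  set b := volume (Metric.ball (0 : EuclideanSpace ℝ (Fin N)) 1)
  have hb0 : b ≠ 0 := (Metric.measure_ball_pos volume _ (by norm_num)).ne'
  have hbt : b ≠ ∞ := measure_ball_lt_top.ne
  set C₁ := K * b⁻¹ * ENNReal.ofReal c⁻¹
  set C₂ := K * b⁻¹ * b ^ (α / N)
  have hC₂ : b ^ (α / N) ≠ ∞ := ENNReal.rpow_ne_top_of_nonneg (by positivity) hbt
  refine ⟨1 + C₁ + C₂, by finiteness, ?_⟩
  intro Φ k w h hk hw x t ht0 htt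
  set F := ∫⁻ y, Φ (w x - w y) * k (x - y)
  set M := (∫⁻ y, Φ (w y) ^ ((N : ℝ) / (N - α))) ^ (1 / ((N : ℝ) / (N - α)))
  rcases le_or_gt 1 t with ht | ht
  · calc Φ (w x) = 1 * (1 * Φ (w x)) := by ring
      _ ≤ (1 + C₁ + C₂) * (t ^ α * (Φ (w x) + F) + t ^ (α - N) * M) := by
        gcongr
        · rw [add_assoc]; exact le_self_add
        · refine le_trans ?_ le_self_add
          gcongr
          · exact ENNReal.one_le_rpow ht hα
          · exact le_self_add
  have hρ : 0 < t.toReal := ENNReal.toReal_pos ht0 htt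
  have hρ1 : t.toReal ≤ 1 := by
    simpa using ENNReal.toReal_mono ENNReal.one_ne_top ht.le
  have key := h.measure_ball_mul_le hN hKt hα hαN hc hk hw x hρ hρ1
  have hvol : volume (Metric.ball x t.toReal) = t ^ (N : ℝ) * b := by
    rw [Measure.addHaar_ball _ _ hρ.le, finrank_euclideanSpace_fin, ENNReal.ofReal_pow hρ.le,
      ENNReal.ofReal_toReal htt, ENNReal.rpow_natCast]
  have hpow : ENNReal.ofReal (c⁻¹ * t.toReal ^ (N + α)) = ENNReal.ofReal c⁻¹ * t ^ (N + α) := by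
    rw [ENNReal.ofReal_mul (by positivity), ← ENNReal.ofReal_rpow_of_pos hρ,
      ENNReal.ofReal_toReal htt]
  have ha : t ^ (-(N : ℝ)) * t ^ (N + α) = t ^ α := by
    rw [← ENNReal.rpow_add _ _ ht0 htt]; congr 1; ring
  have hbN : t ^ (-(N : ℝ)) * (t ^ (N : ℝ) * b) ^ (α / N) = t ^ (α - N) * b ^ (α / N) := by
    rw [ENNReal.mul_rpow_of_nonneg _ _ (by positivity), ← ENNReal.rpow_mul, ← mul_assoc,
      ← ENNReal.rpow_add _ _ ht0 htt]
    congr 2; field_simp; ring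
  have hN1 : t ^ (-(N : ℝ)) * t ^ (N : ℝ) = 1 := by
    rw [← ENNReal.rpow_add _ _ ht0 htt]; simp
  rw [hvol, hpow] at key
  calc Φ (w x) = b⁻¹ * t ^ (-(N : ℝ)) * (t ^ (N : ℝ) * b * Φ (w x)) := by
        rw [show b⁻¹ * t ^ (-(N : ℝ)) * (t ^ (N : ℝ) * b * Φ (w x)) =
          (t ^ (-(N : ℝ)) * t ^ (N : ℝ)) * (b⁻¹ * b) * Φ (w x) by ring, hN1,
          ENNReal.inv_mul_cancel hb0 hbt, one_mul, one_mul]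
    _ ≤ b⁻¹ * t ^ (-(N : ℝ)) * (K * (ENNReal.ofReal c⁻¹ * t ^ (N + α) * F +
          M * (t ^ (N : ℝ) * b) ^ (α / N))) := by gcongr
    _ = K * b⁻¹ * (ENNReal.ofReal c⁻¹ * (t ^ (-(N : ℝ)) * t ^ (N + α)) * F +
          M * (t ^ (-(N : ℝ)) * (t ^ (N : ℝ) * b) ^ (α / N))) := by ring
    _ = C₁ * (t ^ α * F) + C₂ * (t ^ (α - N) * M) := by rw [ha, hbN]; ring
    _ ≤ (1 + C₁ + C₂) * (t ^ α * (Φ (w x) + F)) + (1 + C₁ + C₂) * (t ^ (α - N) * M) := by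
        gcongr
        · rw [add_right_comm]; exact le_add_self
        · exact le_add_self
        · exact le_add_self
    _ = _ := by ring

/-- Optimising the radius in `exists_le_rpow_mul_add`. -/
theorem exists_rpow_le (hN : 0 < N) (hKt : K ≠ ∞) {α c : ℝ} (hα : 0 < α)
    (hαN : α < N) (hc : 0 < c) :
    ∃ C : ℝ≥0∞, C ≠ ∞ ∧ ∀ (Φ : ℝ → ℝ≥0∞) (k : EuclideanSpace ℝ (Fin N) → ℝ≥0∞)
      (w : EuclideanSpace ℝ (Fin N) → ℝ), IsDoubling K Φ →
      (∀ z, 0 < ‖z‖ → ‖z‖ < 1 → ENNReal.ofReal (c * ‖z‖ ^ (-(N : ℝ) - α)) ≤ k z) →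
      Measurable w → ∀ M : ℝ≥0∞,
      M = (∫⁻ y, Φ (w y) ^ ((N : ℝ) / (N - α))) ^ (1 / ((N : ℝ) / (N - α))) → M ≠ 0 → M ≠ ∞ →
      ∀ x, Φ (w x) ^ ((N : ℝ) / (N - α)) ≤
        C * M ^ (α / (N - α)) * (Φ (w x) + ∫⁻ y, Φ (w x - w y) * k (x - y)) := by
  obtain ⟨C, hC, H⟩ := exists_le_rpow_mul_add hN hKt hα hαN hc
  have hN' : (0 : ℝ) < N := by exact_mod_cast hN
  have hNα : (0 : ℝ) < N - α := by linarith
  have hr : 0 < (N : ℝ) / (N - α) := by positivity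
  -- The summand `1` keeps the constant nonzero, so the right side is `∞` when `F = ∞`.
  refine ⟨1 + (2 * C) ^ ((N : ℝ) / (N - α)), ?_, ?_⟩
  · have : (2 * C) ^ ((N : ℝ) / (N - α)) ≠ ∞ :=
      ENNReal.rpow_ne_top_of_nonneg hr.le (by finiteness)
    finiteness
  intro Φ k w h hk hw M hM hM0 hMt x
  have key := H Φ k w h hk hw x
  rw [← hM] at key
  set F := Φ (w x) + ∫⁻ y, Φ (w x - w y) * k (x - y) with hF
  rcases eq_or_ne F 0 with hF0 | hF0
  · have : Φ (w x) = 0 := by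
      rw [hF] at hF0; exact (add_eq_zero.1 hF0).1
    rw [this, ENNReal.zero_rpow_of_pos hr]
    exact zero_le
  rcases eq_or_ne F ∞ with hFt | hFt
  · rw [hFt, ENNReal.mul_top]
    · exact le_top
    · exact mul_ne_zero (by simp) (ENNReal.rpow_pos hM0.bot_lt hMt).ne'
  -- The choice `t = (M / F)^(1/N)` makes both terms equal to `M^(α/N) F^((N-α)/N)`.
  have ht0 : M ^ (1 / (N : ℝ)) * F ^ (-1 / (N : ℝ)) ≠ 0 :=
    mul_ne_zero (ENNReal.rpow_pos hM0.bot_lt hMt).ne' (ENNReal.rpow_pos hF0.bot_lt hFt).ne'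
  have ha : M ^ (1 / (N : ℝ)) ≠ ∞ := ENNReal.rpow_ne_top_of_ne_zero hM0 hMt
  have hb : F ^ (-1 / (N : ℝ)) ≠ ∞ := ENNReal.rpow_ne_top_of_ne_zero hF0 hFt
  have h1 := key (M ^ (1 / (N : ℝ)) * F ^ (-1 / (N : ℝ))) ht0 (by finiteness)
  have e1 : (M ^ (1 / (N : ℝ)) * F ^ (-1 / (N : ℝ))) ^ α * F =
      M ^ (α / N) * F ^ ((N - α) / N) := by
    rw [ENNReal.mul_rpow_of_ne_top ha hb, ← ENNReal.rpow_mul, ← ENNReal.rpow_mul, mul_assoc]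
    nth_rewrite 2 [← ENNReal.rpow_one F]
    rw [← ENNReal.rpow_add _ _ hF0 hFt]
    congr 2 <;> field_simp
    ring
  have e2 : (M ^ (1 / (N : ℝ)) * F ^ (-1 / (N : ℝ))) ^ (α - N) * M =
      M ^ (α / N) * F ^ ((N - α) / N) := by
    rw [ENNReal.mul_rpow_of_ne_top ha hb, ← ENNReal.rpow_mul, ← ENNReal.rpow_mul, mul_right_comm]
    nth_rewrite 2 [← ENNReal.rpow_one M]
    rw [← ENNReal.rpow_add _ _ hM0 hMt]
    congr 2 <;> field_simp <;> ring
  rw [e1, e2] at h1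
  calc Φ (w x) ^ ((N : ℝ) / (N - α))
      ≤ (2 * C * (M ^ (α / N) * F ^ ((N - α) / N))) ^ ((N : ℝ) / (N - α)) := by
        gcongr
        refine h1.trans (le_of_eq (by ring))
    _ = (2 * C) ^ ((N : ℝ) / (N - α)) * M ^ (α / (N - α)) * F := by
        rw [ENNReal.mul_rpow_of_nonneg (2 * C) _ hr.le,
          ENNReal.mul_rpow_of_nonneg (M ^ (α / N)) _ hr.le, ← ENNReal.rpow_mul, ← ENNReal.rpow_mul, ← mul_assoc]
        congr 1
        · congr 2; field_simp
        · rw [show ((N : ℝ) - α) / N * (N / (N - α)) = 1 by field_simp, ENNReal.rpow_one]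
    _ ≤ _ := by
        gcongr
        exact le_add_self

/-! ### The critical Sobolev inequality. -/

/-- The Sobolev inequality, for functions such that the left-hand side is finite. -/
theorem exists_sobolev_of_ne_top (hN : 0 < N) (hK : 1 ≤ K) (hKt : K ≠ ∞) {α c : ℝ} (hα : 0 < α)
    (hαN : α < N) (hc : 0 < c) (R : ℝ) :
    ∃ C : ℝ≥0∞, C ≠ ∞ ∧ ∀ (Φ : ℝ → ℝ≥0∞) (k : EuclideanSpace ℝ (Fin N) → ℝ≥0∞)
      (w : EuclideanSpace ℝ (Fin N) → ℝ), IsDoubling K Φ →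
      (∀ z, 0 < ‖z‖ → ‖z‖ < 1 → ENNReal.ofReal (c * ‖z‖ ^ (-(N : ℝ) - α)) ≤ k z) →
      Measurable w → (∀ x, R ≤ ‖x‖ → w x = 0) →
      ∫⁻ y, Φ (w y) ^ ((N : ℝ) / (N - α)) ≠ ∞ →
      (∫⁻ y, Φ (w y) ^ ((N : ℝ) / (N - α))) ^ (1 / ((N : ℝ) / (N - α))) ≤
        C * ∫⁻ x, ∫⁻ y, Φ (w x - w y) * k (x - y) := by
  have hN' : (0 : ℝ) < N := by exact_mod_cast hN
  have hNα : (0 : ℝ) < N - α := by linarith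
  have hr : 0 < (N : ℝ) / (N - α) := by positivity
  obtain ⟨C₁, hC₁, H₁⟩ := exists_rpow_le hN hKt hα hαN hc
  obtain ⟨C₂, hC₂, H₂⟩ := exists_lintegral_le hN hK hKt
    (ENNReal.ofReal_pos.2 hc).ne' ENNReal.ofReal_ne_top R
  refine ⟨C₁ * (C₂ + 1), by finiteness, ?_⟩
  intro Φ k w h hk hw hw0 hfin
  have hΦ := h.measurable
  have hk' : ∀ z, 0 < ‖z‖ → ‖z‖ < 1 → ENNReal.ofReal c ≤ k z := fun z h0 h1 => by
    refine le_trans (ENNReal.ofReal_le_ofReal ?_) (hk z h0 h1)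
    exact le_mul_of_one_le_right hc.le
      (Real.one_le_rpow_of_pos_of_le_one_of_nonpos h0 h1.le (by linarith))
  set M := (∫⁻ y, Φ (w y) ^ ((N : ℝ) / (N - α))) ^ (1 / ((N : ℝ) / (N - α))) with hM
  have hMt : M ≠ ∞ := ENNReal.rpow_ne_top_of_nonneg (by positivity) hfin
  rcases eq_or_ne M 0 with hM0 | hM0
  · rw [hM0]; exact zero_le
  have hMr : ∫⁻ y, Φ (w y) ^ ((N : ℝ) / (N - α)) = M ^ (α / (N - α)) * M := by
    nth_rewrite 2 [← ENNReal.rpow_one M]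
    rw [← ENNReal.rpow_add _ _ hM0 hMt, hM, ← ENNReal.rpow_mul]
    rw [show 1 / ((N : ℝ) / (N - α)) * (α / (N - α) + 1) = 1 by field_simp; ring, ENNReal.rpow_one]
  have hMp0 : M ^ (α / (N - α)) ≠ 0 := (ENNReal.rpow_pos hM0.bot_lt hMt).ne'
  have hMpt : M ^ (α / (N - α)) ≠ ∞ := ENNReal.rpow_ne_top_of_ne_zero hM0 hMt
  -- As `N/(N-α) = α/(N-α) + 1`, the goal times `M^(α/(N-α))` has the full integral on its left;
  -- undoing this factor requires `M` finite.
  rw [← ENNReal.mul_le_mul_iff_right hMp0 hMpt, ← hMr]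
  calc ∫⁻ y, Φ (w y) ^ ((N : ℝ) / (N - α))
      ≤ ∫⁻ x, C₁ * M ^ (α / (N - α)) * (Φ (w x) + ∫⁻ y, Φ (w x - w y) * k (x - y)) :=
        lintegral_mono (H₁ Φ k w h hk hw M hM hM0 hMt)
    _ = C₁ * M ^ (α / (N - α)) * ((∫⁻ x, Φ (w x)) + ∫⁻ x, ∫⁻ y, Φ (w x - w y) * k (x - y)) := by
        rw [lintegral_const_mul' _ _ (by finiteness), lintegral_add_left (by fun_prop)]
    _ ≤ C₁ * M ^ (α / (N - α)) * (C₂ * (∫⁻ x, ∫⁻ y, Φ (w x - w y) * k (x - y)) +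
          ∫⁻ x, ∫⁻ y, Φ (w x - w y) * k (x - y)) := by
        gcongr
        exact H₂ Φ k w h hk' hw hw0
    _ = _ := by ring

/-- Truncations at height `n` are bounded with bounded support, so their critical integral is
finite; truncating is 1-Lipschitz, so it does not raise the energy. Fatou's lemma passes to the
limit. -/
theorem exists_sobolev (hN : 0 < N) (hK : 1 ≤ K) (hKt : K ≠ ∞) {α c : ℝ} (hα : 0 < α)
    (hαN : α < N) (hc : 0 < c) (R : ℝ) :
    ∃ C : ℝ≥0∞, C ≠ ∞ ∧ ∀ (Φ : ℝ → ℝ≥0∞) (k : EuclideanSpace ℝ (Fin N) → ℝ≥0∞)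
      (w : EuclideanSpace ℝ (Fin N) → ℝ), IsDoubling K Φ →
      (∀ z, 0 < ‖z‖ → ‖z‖ < 1 → ENNReal.ofReal (c * ‖z‖ ^ (-(N : ℝ) - α)) ≤ k z) →
      Measurable w → (∀ x, R ≤ ‖x‖ → w x = 0) →
      (∫⁻ y, Φ (w y) ^ ((N : ℝ) / (N - α))) ^ (1 / ((N : ℝ) / (N - α))) ≤
        C * ∫⁻ x, ∫⁻ y, Φ (w x - w y) * k (x - y) := by
  obtain ⟨C, hC, H⟩ := exists_sobolev_of_ne_top hN hK hKt hα hαN hc R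
  refine ⟨C, hC, fun Φ k w h hk hw hw0 => ?_⟩
  have hΦ := h.measurable
  have hN' : (0 : ℝ) < N := by exact_mod_cast hN
  have hNα : (0 : ℝ) < N - α := by linarith
  have hr : 0 < (N : ℝ) / (N - α) := by positivity
  set E := ∫⁻ x, ∫⁻ y, Φ (w x - w y) * k (x - y)
  set T : ℕ → EuclideanSpace ℝ (Fin N) → ℝ := fun n x => max (-n) (min (w x) n) with hT
  have hTm : ∀ n, Measurable (T n) := fun n => by fun_prop
  have hbd : ∀ n, ∫⁻ y, Φ (T n y) ^ ((N : ℝ) / (N - α)) ≤ (C * E) ^ ((N : ℝ) / (N - α)) := by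
    intro n
    have hn : (0 : ℝ) ≤ n := n.cast_nonneg
    have hT0 : ∀ x, R ≤ ‖x‖ → T n x = 0 := fun x hx => by simp [hT, hw0 x hx]
    have hfin : ∫⁻ y, Φ (T n y) ^ ((N : ℝ) / (N - α)) ≠ ∞ := by
      have hle : ∫⁻ y, Φ (T n y) ^ ((N : ℝ) / (N - α)) ≤
          ∫⁻ _ in Metric.ball (0 : EuclideanSpace ℝ (Fin N)) R, Φ n ^ ((N : ℝ) / (N - α)) := by
        rw [← lintegral_indicator measurableSet_ball]
        refine lintegral_mono fun y => ?_
        by_cases hy : R ≤ ‖y‖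
        · simp [hT0 y hy, h.map_zero, hr]
        · rw [Set.indicator_of_mem (by simpa using hy)]
          gcongr
          refine h.mono _ _ ?_
          rw [abs_of_nonneg hn]
          exact abs_le.2 ⟨le_max_left _ _, max_le (by linarith) (min_le_right _ _)⟩
      refine (hle.trans_lt ?_).ne
      rw [setLIntegral_const]
      exact ENNReal.mul_lt_top (ENNReal.rpow_lt_top_of_nonneg hr.le (h.ne_top _))
        measure_ball_lt_top
    have h1 := H Φ k (T n) h hk (hTm n) hT0 hfin
    rw [one_div, ENNReal.rpow_inv_le_iff hr] at h1
    refine h1.trans ?_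
    gcongr
    refine lintegral_mono fun x => lintegral_mono fun y => ?_
    gcongr
    refine h.mono _ _ ?_
    calc |T n x - T n y| ≤ |min (w x) n - min (w y) n| := by
          simpa using abs_max_sub_max_le_max (-(n : ℝ)) (min (w x) n) (-n) (min (w y) n)
      _ ≤ |w x - w y| := by
          simpa using abs_min_sub_min_le_max (w x) n (w y) n
  have hlim : ∀ y, Filter.liminf (fun n => Φ (T n y) ^ ((N : ℝ) / (N - α))) Filter.atTop =
      Φ (w y) ^ ((N : ℝ) / (N - α)) := by
    intro y
    refine Filter.Tendsto.liminf_eq (tendsto_const_nhds.congr' ?_)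
    obtain ⟨m, hm⟩ := exists_nat_ge |w y|
    filter_upwards [Filter.eventually_ge_atTop m] with n hn
    have hn' : |w y| ≤ n := hm.trans (by exact_mod_cast hn)
    have := abs_le.1 hn'
    simp only [hT]
    rw [min_eq_left this.2, max_eq_right this.1]
  rw [one_div, ENNReal.rpow_inv_le_iff hr]
  calc ∫⁻ y, Φ (w y) ^ ((N : ℝ) / (N - α))
      = ∫⁻ y, Filter.liminf (fun n => Φ (T n y) ^ ((N : ℝ) / (N - α))) Filter.atTop := by
        simp only [hlim]
    _ ≤ Filter.liminf (fun n => ∫⁻ y, Φ (T n y) ^ ((N : ℝ) / (N - α))) Filter.atTop :=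
        lintegral_liminf_le fun n => by fun_prop
    _ ≤ _ := by
        refine Filter.liminf_le_of_le (by isBoundedDefault) fun b hb => ?_
        obtain ⟨n, hn⟩ := hb.exists
        exact hn.trans (hbd n)

end IsDoubling

end NonlocalOrlicz

/-! ### Measurable representatives and the final theorem. -/

namespace NonlocalOrlicz

/-- A function of `W₀^{J,Ψ}(Ω)` has a measurable representative vanishing outside `Ω`. -/
theorem exists_measurable_ae_eq {N : ℕ} {J : EuclideanSpace ℝ (Fin N) → ℝ} {Ψ : ℝ → ℝ}
    {Ω : Set (EuclideanSpace ℝ (Fin N))} (hΩ : MeasurableSet Ω)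
    {u : EuclideanSpace ℝ (Fin N) → ℝ} (hu : u ∈ sobolevSpaceZero J Ψ Ω) :
    ∃ w : EuclideanSpace ℝ (Fin N) → ℝ, Measurable w ∧ (∀ x, x ∉ Ω → w x = 0) ∧ u =ᵐ[volume] w := by
  obtain ⟨⟨⟨hm, -⟩, -⟩, h0⟩ := hu
  rw [Measure.restrict_univ] at hm
  refine ⟨Ω.indicator (hm.mk u), hm.measurable_mk.indicator hΩ,
    fun x hx => Set.indicator_of_notMem hx _, ?_⟩
  filter_upwards [hm.ae_eq_mk, h0] with x hx hx0
  by_cases hxΩ : x ∈ Ω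
  · rw [Set.indicator_of_mem hxΩ, hx]
  · rw [Set.indicator_of_notMem hxΩ, hx0 hxΩ]

theorem IsGamma.two_mul_energy {N : ℕ} {p q : ℝ} {J : EuclideanSpace ℝ (Fin N) → ℝ} {Ψ : ℝ → ℝ}
    (h : IsGamma p q Ψ) {u w : EuclideanSpace ℝ (Fin N) → ℝ} (huw : u =ᵐ[volume] w) :
    2 * energy J Ψ u =
      ∫⁻ x, ∫⁻ y, ENNReal.ofReal (Ψ (w x - w y)) * ENNReal.ofReal (J (x - y)) := by
  rw [energy, ← mul_assoc, ENNReal.mul_inv_cancel two_ne_zero ENNReal.ofNat_ne_top, one_mul]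
  refine lintegral_congr_ae ?_
  filter_upwards [huw] with x hx
  refine lintegral_congr_ae ?_
  filter_upwards [huw] with y hy
  rw [hx, hy, ENNReal.ofReal_mul (h.nonneg _)]

end NonlocalOrlicz

theorem theorem3p2 (N : ℕ) (p q α c : ℝ) (hq : 1 < q) (hqp : q ≤ p)
    (hα : 0 < α) (hαN : α < (N : ℝ)) (hc : 0 < c)
    (Ω : Set (EuclideanSpace ℝ (Fin N))) (hΩ : IsOpen Ω) (hΩb : Bornology.IsBounded Ω) :
    ∃ C : ℝ, 0 < C ∧
      ∀ (J : EuclideanSpace ℝ (Fin N) → ℝ), NonlocalOrlicz.IsKernel J →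
        (∀ z : EuclideanSpace ℝ (Fin N), 0 < ‖z‖ → ‖z‖ < 1 → c * ‖z‖ ^ (-(N : ℝ) - α) ≤ J z) →
      ∀ (Ψ : ℝ → ℝ), NonlocalOrlicz.IsGamma p q Ψ →
      ∀ u ∈ NonlocalOrlicz.sobolevSpaceZero J Ψ Ω,
      ∀ r : ℝ, 1 ≤ r → r ≤ (N : ℝ) / ((N : ℝ) - α) →
        u ∈ NonlocalOrlicz.orliczSpace (fun s => Ψ s ^ r) Ω ∧
        eLpNorm (fun x => Ψ (u x)) (ENNReal.ofReal r) (volume.restrict Ω) ≤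
          ENNReal.ofReal C * NonlocalOrlicz.energy J Ψ u := by
  have hN' : (0 : ℝ) < N := hα.trans hαN
  have hN : 0 < N := by exact_mod_cast hN'
  have hNα : (0 : ℝ) < N - α := by linarith
  have hp : 0 ≤ p := by linarith
  have hK : 1 ≤ ENNReal.ofReal (2 ^ p) :=
    ENNReal.one_le_ofReal.2 (Real.one_le_rpow one_le_two hp)
  obtain ⟨R, hR⟩ := hΩb.subset_ball 0
  obtain ⟨C, hC, H⟩ := NonlocalOrlicz.IsDoubling.exists_sobolev hN hK ENNReal.ofReal_ne_top
    hα hαN hc R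
  have hvol : volume Ω ≠ ∞ := hΩb.measure_lt_top.ne
  -- The `2` undoes the `1/2` in the energy. The factor `1 + volume Ω` dominates every Hölder factor
  -- `volume Ω ^ (1/r - 1/rs)`, whose exponent lies in `[0, 1]`, so `D` is independent of `r`.
  set D := 2 * C * (1 + volume Ω)
  have hD : D ≠ ∞ := by finiteness
  refine ⟨D.toReal + 1, by positivity, ?_⟩
  intro J _ hJ Ψ hΨ u hu r hr1 hr
  have hq0 : 0 < q := by linarith
  have hdoub := hΨ.isDoubling hq0
  have hr0 : 0 < r := by linarith
  obtain ⟨w, hw, hw0, huw⟩ := NonlocalOrlicz.exists_measurable_ae_eq hΩ.measurableSet hu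
  have hwR : ∀ x, R ≤ ‖x‖ → w x = 0 := fun x hx => hw0 x fun hxΩ => by
    have := hR hxΩ
    rw [mem_ball_zero_iff] at this
    linarith
  have hsob := H _ (fun z => ENNReal.ofReal (J z)) w hdoub
    (fun z h0 h1 => ENNReal.ofReal_le_ofReal (hJ z h0 h1)) hw hwR
  rw [← hΨ.two_mul_energy huw] at hsob
  set rs : ℝ := (N : ℝ) / (N - α) with hrs
  have hrs0 : 0 < rs := by positivity
  have hnorm : ∀ s : ℝ, 0 < s → eLpNorm (fun x => Ψ (u x)) (ENNReal.ofReal s) (volume.restrict Ω) =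
      (∫⁻ x in Ω, ENNReal.ofReal (Ψ (u x)) ^ s) ^ (1 / s) := fun s hs => by
    rw [eLpNorm_eq_lintegral_rpow_enorm_toReal (by simpa using hs) ENNReal.ofReal_ne_top,
      ENNReal.toReal_ofReal hs.le]
    simp only [Real.enorm_of_nonneg (hΨ.nonneg _)]
  have hmeas : AEMeasurable u := ⟨w, hw, huw⟩
  have hΨu : AEStronglyMeasurable (fun x => Ψ (u x)) (volume.restrict Ω) :=
    (hΨ.continuous.measurable.comp_aemeasurable hmeas).aestronglyMeasurable.restrict
  have hmain : eLpNorm (fun x => Ψ (u x)) (ENNReal.ofReal r) (volume.restrict Ω) ≤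
      ENNReal.ofReal (D.toReal + 1) * NonlocalOrlicz.energy J Ψ u := by
    have hexp : 0 ≤ 1 / r - 1 / rs ∧ 1 / r - 1 / rs ≤ 1 := by
      have h1 : 1 / rs ≤ 1 / r := one_div_le_one_div_of_le hr0 hr
      have h2 : 1 / r ≤ 1 := by rw [div_le_one hr0]; exact hr1
      have h3 : 0 < 1 / rs := by positivity
      constructor <;> linarith
    calc eLpNorm (fun x => Ψ (u x)) (ENNReal.ofReal r) (volume.restrict Ω)
        ≤ eLpNorm (fun x => Ψ (u x)) (ENNReal.ofReal rs) (volume.restrict Ω) *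
            volume Ω ^ (1 / r - 1 / rs) := by
          have := eLpNorm_le_eLpNorm_mul_rpow_measure_univ (ENNReal.ofReal_le_ofReal hr) hΨu
          rwa [ENNReal.toReal_ofReal hr0.le, ENNReal.toReal_ofReal hrs0.le,
            Measure.restrict_apply_univ] at this
      _ ≤ C * (2 * NonlocalOrlicz.energy J Ψ u) * (1 + volume Ω) := by
          gcongr
          · rw [hnorm rs hrs0]
            refine le_trans ?_ hsob
            refine ENNReal.rpow_le_rpow ?_ (by positivity)
            refine (setLIntegral_le_lintegral _ _).trans_eq (lintegral_congr_ae ?_)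
            filter_upwards [huw] with x hx
            rw [hx]
          · calc volume Ω ^ (1 / r - 1 / rs) ≤ (1 + volume Ω) ^ (1 / r - 1 / rs) := by
                  gcongr
                  · exact hexp.1
                  · exact le_add_self
              _ ≤ (1 + volume Ω) ^ (1 : ℝ) :=
                  ENNReal.rpow_le_rpow_of_exponent_le le_self_add hexp.2
              _ = 1 + volume Ω := ENNReal.rpow_one _
      _ = D * NonlocalOrlicz.energy J Ψ u := by ring
      _ ≤ _ := by
          gcongr
          rw [← ENNReal.ofReal_toReal hD]
          exact ENNReal.ofReal_le_ofReal (by simp)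
  refine ⟨⟨hmeas.restrict, ?_⟩, hmain⟩
  -- Membership in the Orlicz space follows from the norm bound, as the energy is finite.
  have hlt := hmain.trans_lt (ENNReal.mul_lt_top ENNReal.ofReal_lt_top hu.1.2)
  rw [hnorm r hr0, ENNReal.rpow_lt_top_iff_of_pos (by positivity)] at hlt
  simpa only [ENNReal.ofReal_rpow_of_nonneg (hΨ.nonneg _) hr0.le] using hlt
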